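/- Let $T : A \to O^*\times O^*$ be a graphical signature ($O$, $A$ sets, $O^*$ the finite words in $O$). Its typegraph $T_{\mathcal G}$ has point set $O+A$, a self-loop at each $o\in O$, and for each $a\in A$ with $T(a)=(D,C)$ one edge from $d$ to $a$ for each letter occurrence $d$ in $D$ and one edge from $a$ to $c$ for each letter occurrence $c$ in $C$. A *typed open-graph* is a directed multigraph $G$ with a graph map $\tau:G\to T_{\mathcal G}$ such that at every vertex (a point with $\tau$-value in $A$) $\tau$ restricts to a bijection of the sets of adjacent edges, and every edge-point (a point with $\tau$-value in $O$) has at most one in-edge and at most one out-edge. Typed open-graphs form a full subcategory $\mathbf{OGraph}_{T_{\mathcal G}}$ of $\mathbf{Graph}/T_{\mathcal G}$. $\mathrm{In}(G)$ (resp. $\mathrm{Out}(G)$) is the set of edge-points without in-edges (resp. out-edges); an isolated point is a point of $\mathrm{In}(G)\cap\mathrm{Out}(G)$. A pushout in $\mathbf{OGraph}_{T_{\mathcal G}}$ is *adhesive* if it is preserved by the embedding into $\mathbf{Graph}/T_{\mathcal G}$. A *rewrite rule* $L\rightsquigarrow R$ is a span of monomorphisms $L \xleftarrow{b_1} B \xrightarrow{b_2}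 R$ in $\mathbf{OGraph}_{T_{\mathcal G}}$, where $B$ has no edges and its points split into two parts which both $b_1$ and $b_2$ map bijectively onto the inputs, respectively the outputs, of $L$ and of $R$. A *matching* of the rule on $G$ is a monomorphism $m:L\to G$ such that $B\to L\to G$ has an adhesive pushout complement $B\to K\xrightarrow{s} G$; then $G[L\rightsquigarrow R]_m$ is the adhesive pushout of $K\leftarrow B\to R$, with $s':K\to G[L\rightsquigarrow R]_m$. For words $X,Y\in O^*$, regarded as edgeless graphs of typed points, a *directed cospan* $\mathcal G:X\to Y$ is a pair of maps $Y\xrightarrow{c} G\xleftarrow{d} X$ in $\mathbf{OGraph}_{T_{\mathcal G}}$, where $d$ is a bijection of $X$ onto $\mathrm{In}(G)$ and $c$ a bijection of $Y$ onto $\mathrm{Out}(G)$. Composition $\mathcal H\circ\mathcal G$ is by pushout in $\mathbf{OGraph}_{T_{\mathcal G}}$ over the shared word, the identity of $X$ is $X\xrightarrow{1}X\xleftarrow{1}X$, and $\cong$ is isomorphism of graphs commuting with both legs. For a matching $m$ on $G$, $\mathcal G[L\rightsquigarrow R]_m$ is the directed cospan $X\to Y$ on $G[L\rightsquigarrow R]_m$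 with legs $s'd'$, $s'c'$, where $sd'=d$, $sc'=c$. **Theorem.** Composites of directed cospans, and the cospan $\mathcal G[L\rightsquigarrow R]_m$ for every matching $m$ on $G$, exist and are unique up to isomorphism of cospans. Let $\mathcal G:X\to Y$ and $\mathcal H:Y\to Z$ be directed cospans of typed open-graphs. For every rule $L\rightsquigarrow R$ and every matching $m$ of it on $\mathcal G$ there is a matching $m'$ on $\mathcal H\circ\mathcal G$ with $$\mathcal H\circ(\mathcal G[L\rightsquigarrow R]_m)\cong(\mathcal H\circ\mathcal G)[L\rightsquigarrow R]_{m'},$$ and for every matching $n$ of it on $\mathcal H$ there is a matching $n'$ on $\mathcal H\circ\mathcal G$ with $$(\mathcal H[L\rightsquigarrow R]_n)\circ\mathcal G\cong(\mathcal H\circ\mathcal G)[L\rightsquigarrow R]_{n'}.$$ Consequently, for every set $\mathbb S$ of rewrite rules, the equivalence relation on directed cospans generated by isomorphism and by rewriting with rules of $\mathbb S$ is a congruence for composition, and the words in $O^*$ with the equivalence classes of cospans as arrows, composition induced by composition of cospans, and the classes of the identity cospans as identities, form a category (the rewrite category of $\mathbb S$). Moreover, composites of cospans whose graphs have no isolated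 points have none, and the graph of $\mathcal G$ has no isolated points if and only if that of $\mathcal G[L\rightsquigarrow R]_m$ has none. -/

import Mathlib

open CategoryTheory CategoryTheory.Limits

universe u

namespace TypedOpenGraph

/-- Directed multigraphs, as functors from `E ⇉ P` to sets: `zero` is the object of edges,
`one` the object of points, `left` is the source map and `right` the target map. -/
abbrev Graph : Type (u + 1) := WalkingParallelPair ⥤ Type u

namespace Graph

abbrev Points (G : Graph.{u}) : Type u := G.obj .one

abbrev Edges (G : Graph.{u}) : Type u := G.obj .zero

abbrev src (G : Graph.{u}) (e : G.Edges) : G.Points := G.map .left e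

abbrev tgt (G : Graph.{u}) (e : G.Edges) : G.Points := G.map .right e

/-- The edge neighbourhood `N(p)`: the set of edges adjacent to the point `p`. -/
def nbhd (G : Graph.{u}) (p : G.Points) : Set G.Edges := {e | G.src e = p ∨ G.tgt e = p}

end Graph

section Signature

variable {O A : Type u} (T : A → List O × List O)

/-- Edges of the typegraph: a self-loop for every `o : O`, and for every `a : A` one edge for each
position of the input word and one for each position of the output word of `a`. -/
inductive TypeEdge : Type u
  | loop (o : O)
  | input (a : A) (k : Fin (T a).1.length)
  | output (a : A) (k : Fin (T a).2.length)

namespace TypeEdge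

variable {T}

def src : TypeEdge T → O ⊕ A
  | loop o => .inl o
  | input a k => .inl ((T a).1.get k)
  | output a _ => .inr a

def tgt : TypeEdge T → O ⊕ A
  | loop o => .inl o
  | input a _ => .inr a
  | output a k => .inl ((T a).2.get k)

end TypeEdge

/-- The typegraph of the graphical signature `T : A → O* × O*`; its points are `O + A`. -/
def typeGraph : Graph.{u} :=
  parallelPair (TypeCat.ofHom (TypeEdge.src (T := T))) (TypeCat.ofHom (TypeEdge.tgt (T := T)))

/-- Graphs typed by the typegraph: the slice category over it. -/
abbrev TGraph : Type (u + 1) := Over (typeGraph T)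

variable {T}

namespace TGraph

def typeOf (G : TGraph T) (p : G.left.Points) : O ⊕ A := G.hom.app .one p

def IsEdgePoint (G : TGraph T) (p : G.left.Points) : Prop := ∃ o : O, G.typeOf p = .inl o

def IsVertex (G : TGraph T) (p : G.left.Points) : Prop := ∃ a : A, G.typeOf p = .inr a

/-- A graph map out of a typed graph is a local isomorphism if at every vertex it restricts to a
bijection of edge neighbourhoods. -/
def IsLocalIso (G : TGraph T) {H : Graph.{u}} (f : G.left ⟶ H) : Prop :=
  ∀ p : G.left.Points, G.IsVertex p →
    Set.BijOn (fun e : G.left.Edges => f.app .zero e) (G.left.nbhd p) (H.nbhd (f.app .one p))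

/-- `In(G)`: the edge-points without in-edges. -/
def inputs (G : TGraph T) : Set G.left.Points :=
  {p | G.IsEdgePoint p ∧ ∀ e, G.left.tgt e ≠ p}

/-- `Out(G)`: the edge-points without out-edges. -/
def outputs (G : TGraph T) : Set G.left.Points :=
  {p | G.IsEdgePoint p ∧ ∀ e, G.left.src e ≠ p}

/-- A typed graph is a typed open-graph if its typing map is a local isomorphism and every
edge-point has at most one in-edge and at most one out-edge. -/
structure IsOpen (G : TGraph T) : Prop where
  localIso : G.IsLocalIso G.hom
  in_unique : ∀ p, G.IsEdgePoint p → ∀ e e', G.left.tgt e = p → G.left.tgt e' = p → e = e'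
  out_unique : ∀ p, G.IsEdgePoint p → ∀ e e', G.left.src e = p → G.left.src e' = p → e = e'

/-- Maps of typed graphs whose typing maps are local isomorphisms are automatically local
isomorphisms, so that typed open-graphs and local isomorphisms form a full subcategory. -/
theorem isLocalIso_of_hom {G H : TGraph T} (hG : G.IsLocalIso G.hom) (hH : H.IsLocalIso H.hom)
    (f : G ⟶ H) : G.IsLocalIso f.left := by
  intro p hp
  have hw1 : ∀ q, H.hom.app .one (f.left.app .one q) = G.hom.app .one q := fun q =>
    ConcreteCategory.congr_hom (congrArg (fun a => NatTrans.app a WalkingParallelPair.one)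
      (Over.w f)) q
  have hw0 : ∀ q, H.hom.app .zero (f.left.app .zero q) = G.hom.app .zero q := fun q =>
    ConcreteCategory.congr_hom (congrArg (fun a => NatTrans.app a WalkingParallelPair.zero)
      (Over.w f)) q
  have hv : H.IsVertex (f.left.app .one p) := by
    obtain ⟨a, ha⟩ := hp
    exact ⟨a, (hw1 p).trans ha⟩
  have h1 := hG p hp
  have h2 := hH _ hv
  rw [hw1 p] at h2
  have hmaps : Set.MapsTo (fun e : G.left.Edges => f.left.app .zero e) (G.left.nbhd p)
      (H.left.nbhd (f.left.app .one p)) := by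
    rintro e (he | he)
    · left
      rw [← he]
      exact (ConcreteCategory.congr_hom (f.left.naturality .left) e).symm
    · right
      rw [← he]
      exact (ConcreteCategory.congr_hom (f.left.naturality .right) e).symm
  refine ⟨hmaps, ?_, ?_⟩
  · intro e he e' he' hee
    refine h1.injOn he he' ?_
    have := congrArg (fun x => H.hom.app .zero x) hee
    simpa only [hw0] using this
  · intro e he
    obtain ⟨e', he', hee⟩ := h1.surjOn (h2.mapsTo he)
    refine ⟨e', he', h2.injOn (hmaps he') he ?_⟩
    simpa only [hw0] using hee

end TGraph

variable (T)

/-- The category of typed open-graphs. -/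
abbrev OGraph : Type (u + 1) :=
  ObjectProperty.FullSubcategory (fun G : TGraph T => G.IsOpen)

/-- The embedding of typed open-graphs into typed graphs. -/
abbrev embedding : OGraph T ⥤ TGraph T :=
  ObjectProperty.ι (fun G : TGraph T => G.IsOpen)

variable {T}

namespace OGraph

abbrev Points (G : OGraph T) : Type u := G.obj.left.Points

abbrev Edges (G : OGraph T) : Type u := G.obj.left.Edges

abbrev inputs (G : OGraph T) : Set G.Points := G.obj.inputs

abbrev outputs (G : OGraph T) : Set G.Points := G.obj.outputs

/-- The action of a morphism of typed open-graphs on points. -/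
def onPoints {G H : OGraph T} (f : G ⟶ H) (p : G.Points) : H.Points := f.hom.left.app .one p

/-- No edge-point is both an input and an output. -/
def NoIsolatedPoints (G : OGraph T) : Prop := Disjoint G.inputs G.outputs

end OGraph

/-- A square of typed open-graphs is an adhesive pushout if it is a pushout and this pushout is
preserved by the embedding into typed graphs. -/
structure IsAdhesivePushout {Z X Y P : OGraph T} (f : Z ⟶ X) (g : Z ⟶ Y) (inl : X ⟶ P)
    (inr : Y ⟶ P) : Prop where
  isPushout : IsPushout f g inl inr
  preserved : IsPushout ((embedding T).map f) ((embedding T).map g) ((embedding T).map inl)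
    ((embedding T).map inr)

variable (T)

/-- A rewrite rule `L ← B → R`: a span of monomorphisms by which `L` and `R` share the same
boundary `B`. That is, `B` is a point-graph that splits into an input part `I` and its complement,
`b₁` identifies `I` with `In(L)` and the complement with `Out(L)`, and `b₂` identifies the same `I`
with `In(R)` and the same complement with `Out(R)`. -/
structure RewriteRule : Type (u + 1) where
  L : OGraph T
  B : OGraph T
  R : OGraph T
  b₁ : B ⟶ L
  b₂ : B ⟶ R
  mono₁ : Mono b₁
  mono₂ : Mono b₂
  noEdges : IsEmpty B.Edges
  sameBoundary : ∃ I : Set B.Points,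
    Set.BijOn (OGraph.onPoints b₁) I L.inputs ∧ Set.BijOn (OGraph.onPoints b₁) Iᶜ L.outputs ∧
    Set.BijOn (OGraph.onPoints b₂) I R.inputs ∧ Set.BijOn (OGraph.onPoints b₂) Iᶜ R.outputs

variable {T}

/-- A matching of the rule `ρ` on `G`: a monomorphism `m : L ⟶ G` such that `B ⟶ L ⟶ G` has an
adhesive pushout complement. -/
def IsMatching (ρ : RewriteRule T) {G : OGraph T} (m : ρ.L ⟶ G) : Prop :=
  Mono m ∧ ∃ (G' : OGraph T) (k : ρ.B ⟶ G') (s : G' ⟶ G), IsAdhesivePushout ρ.b₁ k m s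

variable (T)

/-- The point-graph of a word: one isolated point for each letter, typed by that letter. -/
def pointGraph (X : List O) : OGraph T where
  obj := Over.mk (Y := (parallelPair (TypeCat.ofHom PEmpty.elim) (TypeCat.ofHom PEmpty.elim) :
      Graph.{u}))
    (parallelPairHom (X := PEmpty.{u + 1}) (Y := ULift.{u} (Fin X.length))
      (TypeCat.ofHom PEmpty.elim) (TypeCat.ofHom PEmpty.elim)
      (TypeCat.ofHom (TypeEdge.src (T := T))) (TypeCat.ofHom (TypeEdge.tgt (T := T)))
      (TypeCat.ofHom PEmpty.elim)
      (TypeCat.ofHom fun i => Sum.inl (X.get i.down))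
      (by ext e; exact e.elim) (by ext e; exact e.elim))
  property :=
    { localIso := by
        rintro p ⟨a, ha⟩
        exact absurd ha Sum.inl_ne_inr
      in_unique := fun _ _ e => PEmpty.elim e
      out_unique := fun _ _ e => PEmpty.elim e }

/-- A directed cospan `X → G ← Y` from the word `X` to the word `Y`: `dom` is the inclusion of
`In(G) ≅ X` and `cod` is the inclusion of `Out(G) ≅ Y`. Isolated points are allowed, since the
identity cospans have them. -/
structure DCospan (X Y : List O) : Type (u + 1) where
  graph : OGraph T
  dom : pointGraph T X ⟶ graph
  cod : pointGraph T Y ⟶ graph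
  dom_bij : Set.BijOn (OGraph.onPoints dom) Set.univ graph.inputs
  cod_bij : Set.BijOn (OGraph.onPoints cod) Set.univ graph.outputs

variable {T}

namespace DCospan

variable {X Y Z : List O}

/-- Isomorphism of cospans: an isomorphism of typed graphs that commutes with both legs. -/
def Iso (𝒢 ℋ : DCospan T X Y) : Prop :=
  ∃ e : 𝒢.graph ≅ ℋ.graph, 𝒢.dom ≫ e.hom = ℋ.dom ∧ 𝒢.cod ≫ e.hom = ℋ.cod

/-- `𝒦` is a composite `ℋ ∘ 𝒢`: its graph is a pushout of the graphs of `𝒢` and `ℋ` over the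
shared word `Y`, and its legs are the outer legs of `𝒢` and `ℋ`. -/
def IsComp (𝒢 : DCospan T X Y) (ℋ : DCospan T Y Z) (𝒦 : DCospan T X Z) : Prop :=
  ∃ (i : 𝒢.graph ⟶ 𝒦.graph) (j : ℋ.graph ⟶ 𝒦.graph),
    IsPushout 𝒢.cod ℋ.dom i j ∧ 𝒦.dom = 𝒢.dom ≫ i ∧ 𝒦.cod = ℋ.cod ≫ j

/-- `𝒢'` is the cospan `𝒢[L ⇝ R]_m`: its graph is obtained by the double pushout of adhesive
pushouts, and the legs of `𝒢` and of `𝒢'` are induced by the same maps into the complement `K`. -/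
def IsRewrite (ρ : RewriteRule T) (𝒢 : DCospan T X Y) (m : ρ.L ⟶ 𝒢.graph)
    (𝒢' : DCospan T X Y) : Prop :=
  IsMatching ρ m ∧
  ∃ (K : OGraph T) (k : ρ.B ⟶ K) (s : K ⟶ 𝒢.graph) (s' : K ⟶ 𝒢'.graph) (n : ρ.R ⟶ 𝒢'.graph),
    IsAdhesivePushout ρ.b₁ k m s ∧ IsAdhesivePushout ρ.b₂ k n s' ∧
    (∃ d' : pointGraph T X ⟶ K, d' ≫ s = 𝒢.dom ∧ d' ≫ s' = 𝒢'.dom) ∧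
    ∃ c' : pointGraph T Y ⟶ K, c' ≫ s = 𝒢.cod ∧ c' ≫ s' = 𝒢'.cod

/-- `𝒢` rewrites to `ℋ` in one step of the rewrite system `𝕊`. -/
def RewritesTo (𝕊 : Set (RewriteRule T)) (𝒢 ℋ : DCospan T X Y) : Prop :=
  ∃ ρ ∈ 𝕊, ∃ (m : ρ.L ⟶ 𝒢.graph) (𝒢' : DCospan T X Y), IsRewrite ρ 𝒢 m 𝒢' ∧ Iso 𝒢' ℋ

/-- The closure of rewriting to an equivalence relation; isomorphic cospans are identified. -/
def RewriteEquiv (𝕊 : Set (RewriteRule T)) : DCospan T X Y → DCospan T X Y → Prop :=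
  Relation.EqvGen fun 𝒢 ℋ => Iso 𝒢 ℋ ∨ RewritesTo 𝕊 𝒢 ℋ

/-- The identity cospan of a word. -/
def identity (X : List O) : DCospan T X X where
  graph := pointGraph T X
  dom := 𝟙 _
  cod := 𝟙 _
  dom_bij := ⟨fun i _ => ⟨⟨X.get i.down, rfl⟩, fun e => PEmpty.elim e⟩, fun _ _ _ _ h => h,
    fun i _ => ⟨i, trivial, rfl⟩⟩
  cod_bij := ⟨fun i _ => ⟨⟨X.get i.down, rfl⟩, fun e => PEmpty.elim e⟩, fun _ _ _ _ h => h,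
    fun i _ => ⟨i, trivial, rfl⟩⟩

end DCospan

/-- The arrows `X → Y` of the rewrite category of `𝕊`: classes of cospans under rewriting. -/
def RewriteHom (𝕊 : Set (RewriteRule T)) (X Y : List O) : Type (u + 1) :=
  Quotient (Relation.EqvGen.setoid
    fun 𝒢 ℋ : DCospan T X Y => DCospan.Iso 𝒢 ℋ ∨ DCospan.RewritesTo 𝕊 𝒢 ℋ)

/-- The class of a cospan in the rewrite category. -/
def RewriteHom.mk (𝕊 : Set (RewriteRule T)) {X Y : List O} (𝒢 : DCospan T X Y) :
    RewriteHom 𝕊 X Y :=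
  Quotient.mk _ 𝒢

end Signature

end TypedOpenGraph

/-!
Composing and rewriting cospans both glue typed open-graphs along a point-graph. The glued graph is
open exactly when no point of the point-graph receives an in-edge, or an out-edge, from both sides,
and the gluing is then an adhesive pushout. For a composite this holds because the shared word is
the output boundary of one graph and the input boundary of the other; for a rewrite, because `L` and
`R` have the same boundary `B`.

To rewrite inside a composite, glue the other cospan onto the complement `K` of the matching instead
of onto `G`. By pasting of pushouts the result is a complement of the matching in the composite, and
filling it with `R` instead of `L` gives the composite with the rewritten cospan. Uniqueness of the
rewritten cospan is the uniqueness of pushout complements of monomorphisms in an adhesive category.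
-/

namespace TypedOpenGraph

section Pushouts

variable {C : Type*} [Category* C] {B L K K' G : C} {b : B ⟶ L} {k : B ⟶ K} {k' : B ⟶ K'}
  {s' : K' ⟶ G} {m : L ⟶ G} {s : K ⟶ G}

-- By the van Kampen property, pulling the second square back along `s` exhibits `K` as the pushout
-- of `B` and `K ×[G] K'` over `B`, so the projection `K ×[G] K' ⟶ K` is invertible.
theorem exists_hom_of_isPushoutComplement [Adhesive C] [Mono b] (h : IsPushout b k m s)
    (h' : IsPushout b k' m s') : ∃ φ : K ⟶ K', φ ≫ s' = s := by
  have hs : IsPullback k b s m := (Adhesive.isPullback_of_isPushout_of_mono_left h).flip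
  have : Mono s := Adhesive.mono_of_isPushout_of_mono_left h
  have hw : IsPullback (pullback.lift k k' (h.w.symm.trans h'.w)) (𝟙 B) (pullback.snd s s') k' := by
    refine .of_right ?_ (by simp [pullback.lift_snd]) (IsPullback.of_hasPullback s s')
    simpa [pullback.lift_fst, ← h'.w] using ((IsKernelPair.id_of_mono b).paste_vert hs.flip).flip
  have hpush : IsPushout (𝟙 B) (pullback.lift k k' _) k (pullback.fst s s') :=
    (Adhesive.van_kampen h' _ _ _ _ _ _ _ _ (IsKernelPair.id_of_mono b) hw ⟨hs.w⟩
      ⟨pullback.condition⟩ ⟨by simp [pullback.lift_fst]⟩).2 ⟨hs, IsPullback.of_hasPullback s s'⟩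
  have : IsIso (pullback.fst s s') := hpush.isIso_inr_of_isIso
  exact ⟨inv (pullback.fst s s') ≫ pullback.snd s s', by simp [← pullback.condition]⟩

theorem exists_iso_of_isPushoutComplement [Adhesive C] [Mono b] (h : IsPushout b k m s)
    (h' : IsPushout b k' m s') : ∃ φ : K ≅ K', k ≫ φ.hom = k' ∧ φ.hom ≫ s' = s := by
  have : Mono s := Adhesive.mono_of_isPushout_of_mono_left h
  have : Mono s' := Adhesive.mono_of_isPushout_of_mono_left h'
  obtain ⟨φ, hφ⟩ := exists_hom_of_isPushoutComplement h h'
  obtain ⟨ψ, hψ⟩ := exists_hom_of_isPushoutComplement h' h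
  refine ⟨⟨φ, ψ, ?_, ?_⟩, ?_, hφ⟩
  · simp [← cancel_mono s, hφ, hψ]
  · simp [← cancel_mono s', hφ, hψ]
  · simp [← cancel_mono s', hφ, ← h.w, h'.w]

theorem exists_iso_of_isPushout_of_iso {G' : C} {n : L ⟶ G'} {t : K' ⟶ G'}
    (h : IsPushout b k m s) (h' : IsPushout b k' n t) (φ : K ≅ K') (hφ : k ≫ φ.hom = k') :
    ∃ e : G ≅ G', s ≫ e.hom = φ.hom ≫ t := by
  have h'' : IsPushout b k n (φ.hom ≫ t) :=
    h'.of_iso (Iso.refl _) (Iso.refl _) φ.symm (Iso.refl _) (by simp) (by simp [← hφ]) (by simp)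
      (by simp)
  exact ⟨h.isoIsPushout _ _ h'', h.inr_isoIsPushout_hom _ _ h''⟩

end Pushouts

section Sets

variable {α β γ : Type*} {s : β → γ} {V : Set γ}

theorem bijOn_comp_iff_bijOn_preimage {d : α → β} {S : Set α} (hs : Function.Injective s)
    (hV : V ⊆ Set.range s) : Set.BijOn (s ∘ d) S V ↔ Set.BijOn d S (s ⁻¹' V) := by
  have hsV : Set.BijOn s (s ⁻¹' V) V := ⟨fun _ h => h, hs.injOn, fun v hv => by
    obtain ⟨b, rfl⟩ := hV hv
    exact ⟨b, hv, rfl⟩⟩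
  refine ⟨fun h => ⟨h.mapsTo, h.injOn.of_comp, fun b hb => ?_⟩, hsV.comp⟩
  obtain ⟨a, ha, hab⟩ := h.surjOn hb
  exact ⟨a, ha, hs hab⟩

theorem disjoint_iff_disjoint_preimage {W : Set γ} (hV : V ⊆ Set.range s) :
    Disjoint V W ↔ Disjoint (s ⁻¹' V) (s ⁻¹' W) := by
  rw [← Set.disjoint_image_left, Set.image_preimage_eq_of_subset hV]

end Sets

variable {O A : Type u} {T : A → List O × List O}

/-- The two ends of an edge: `.left` is the source and `.right` the target. Statements about in-
and out-edges are made for an arbitrary end `ε`, with `G.map ε` as incidence map. -/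
abbrev EdgeEnd : Type := WalkingParallelPair.zero ⟶ WalkingParallelPair.one

theorem Graph.mem_nbhd {G : Graph.{u}} {p : G.Points} {e : G.Edges} :
    e ∈ G.nbhd p ↔ ∃ ε : EdgeEnd, G.map ε e = p :=
  ⟨fun h => h.elim (⟨.left, ·⟩) (⟨.right, ·⟩), by rintro ⟨_ | _, h⟩; exacts [.inl h, .inr h]⟩

namespace TGraph

/-- No edge has the point `p` as its `ε`-end. -/
def IsFree (G : TGraph T) (ε : EdgeEnd) (p : G.left.Points) : Prop := ∀ e, G.left.map ε e ≠ p

/-- The edge-points that are free at `ε`: the outputs for the source end `.left`, the inputs for the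
target end `.right`. -/
def boundary (G : TGraph T) (ε : EdgeEnd) : Set G.left.Points :=
  {p | G.IsEdgePoint p ∧ G.IsFree ε p}

theorem IsEdgePoint.not_isVertex {G : TGraph T} {p : G.left.Points} :
    G.IsEdgePoint p → ¬ G.IsVertex p := by
  rintro ⟨o, ho⟩ ⟨a, ha⟩
  exact Sum.inl_ne_inr (ho.symm.trans ha)

theorem isOpen_iff {G : TGraph T} : G.IsOpen ↔ G.IsLocalIso G.hom ∧ ∀ (ε : EdgeEnd) (e e' : _),
    G.IsEdgePoint (G.left.map ε e) → G.left.map ε e = G.left.map ε e' → e = e' := by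
  refine ⟨fun h => ⟨h.localIso, ?_⟩, fun h => ⟨h.1, ?_, ?_⟩⟩
  · rintro (_ | _) e e' he hee'
    exacts [h.out_unique _ he e e' rfl hee'.symm, h.in_unique _ he e e' rfl hee'.symm]
  · rintro _ hp e e' rfl he'
    exact h.2 .right e e' hp he'.symm
  · rintro _ hp e e' rfl he'
    exact h.2 .left e e' hp he'.symm

section Hom

variable {G H : TGraph T} (f : G ⟶ H)

theorem map_app (ε : EdgeEnd) (e : G.left.Edges) :
    H.left.map ε (f.left.app .zero e) = f.left.app .one (G.left.map ε e) :=
  (NatTrans.naturality_apply f.left ε e).symm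

theorem hom_app_app (j : WalkingParallelPair) (x : G.left.obj j) :
    H.hom.app j (f.left.app j x) = G.hom.app j x :=
  ConcreteCategory.congr_hom (NatTrans.congr_app (Over.w f) j) x

theorem isEdgePoint_app {p : G.left.Points} :
    H.IsEdgePoint (f.left.app .one p) ↔ G.IsEdgePoint p := by
  simp only [IsEdgePoint, typeOf, hom_app_app]

theorem isVertex_app {p : G.left.Points} : H.IsVertex (f.left.app .one p) ↔ G.IsVertex p := by
  simp only [IsVertex, typeOf, hom_app_app]

variable {f} in
theorem IsFree.of_app {ε : EdgeEnd} {p : G.left.Points} (h : H.IsFree ε (f.left.app .one p)) :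
    G.IsFree ε p := by
  rintro e rfl
  exact h _ (map_app f ε e)

variable {f} in
theorem mem_boundary_of_app {ε : EdgeEnd} {p : G.left.Points}
    (h : f.left.app .one p ∈ H.boundary ε) : p ∈ G.boundary ε :=
  ⟨(isEdgePoint_app f).1 h.1, h.2.of_app⟩

theorem mono_iff_injective_app : Mono f ↔ ∀ j, Function.Injective (f.left.app j) := by
  simp only [← mono_iff_injective, ← NatTrans.mono_iff_mono_app]
  exact ⟨fun _ => inferInstance, fun _ => Over.mono_of_mono_left f⟩

theorem app_injective [Mono f] (j : WalkingParallelPair) : Function.Injective (f.left.app j) :=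
  (mono_iff_injective_app f).1 inferInstance j

end Hom

theorem mono_of_injective_of_isEmpty {Z G : TGraph T} [IsEmpty Z.left.Edges] {f : Z ⟶ G}
    (hf : Function.Injective (f.left.app .one)) : Mono f := by
  refine (mono_iff_injective_app f).2 ?_
  rintro (_ | _)
  · exact fun e => isEmptyElim (α := Z.left.Edges) e
  · exact hf

/-- The map of typed graphs out of an edgeless graph with a given action on points. -/
def homOfIsEmpty {Z G : TGraph T} [IsEmpty Z.left.Edges] (φ : Z.left.Points → G.left.Points)
    (hφ : ∀ z, G.typeOf (φ z) = Z.typeOf z) : Z ⟶ G :=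
  Over.homMk
    { app := fun
        | .zero => TypeCat.ofHom isEmptyElim
        | .one => TypeCat.ofHom φ
      naturality := by
        rintro _ _ (_ | _ | _)
        · ext e; exact isEmptyElim (α := Z.left.Edges) e
        · ext e; exact isEmptyElim (α := Z.left.Edges) e
        · simp }
    (by
      ext (_ | _) x
      · exact isEmptyElim (α := Z.left.Edges) x
      · exact hφ x)

theorem hom_ext_of_isEmpty {Z G : TGraph T} [IsEmpty Z.left.Edges] {f g : Z ⟶ G}
    (h : ∀ z, f.left.app .one z = g.left.app .one z) : f = g := by
  ext (_ | _) x
  · exact isEmptyElim (α := Z.left.Edges) x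
  · exact h x

section Pushout

variable {Z X Y P : TGraph T} {f : Z ⟶ X} {g : Z ⟶ Y} {inl : X ⟶ P} {inr : Y ⟶ P}

theorem isPushout_app (h : IsPushout f g inl inr) (j : WalkingParallelPair) :
    IsPushout (f.left.app j) (g.left.app j) (inl.left.app j) (inr.left.app j) :=
  h.map (Over.forget _ ⋙ (evaluation _ _).obj j)

theorem app_w (h : IsPushout f g inl inr) (j : WalkingParallelPair) (z : Z.left.obj j) :
    inl.left.app j (f.left.app j z) = inr.left.app j (g.left.app j z) :=
  ConcreteCategory.congr_hom (isPushout_app h j).w z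

theorem eq_inl_or_eq_inr (h : IsPushout f g inl inr) (j : WalkingParallelPair)
    (p : P.left.obj j) : (∃ x, inl.left.app j x = p) ∨ ∃ y, inr.left.app j y = p :=
  Types.eq_or_eq_of_isPushout (isPushout_app h j) p

theorem exists_of_inl_eq_inr [Mono f] (h : IsPushout f g inl inr) {j : WalkingParallelPair}
    {x : X.left.obj j} {y : Y.left.obj j} (hxy : inl.left.app j x = inr.left.app j y) :
    ∃ z, f.left.app j z = x ∧ g.left.app j z = y :=
  (Types.pushoutCocone_inl_eq_inr_iff_of_isColimit (isPushout_app h j).isColimit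
    (app_injective f j) x y).1 hxy

theorem exists_of_inr_eq_inl [Mono g] (h : IsPushout f g inl inr) {j : WalkingParallelPair}
    {x : X.left.obj j} {y : Y.left.obj j} (hxy : inr.left.app j y = inl.left.app j x) :
    ∃ z, f.left.app j z = x ∧ g.left.app j z = y :=
  (exists_of_inl_eq_inr h.flip hxy).imp fun _ => And.symm

theorem isFree_inl_iff [Mono g] (h : IsPushout f g inl inr) {ε : EdgeEnd} {x : X.left.Points} :
    P.IsFree ε (inl.left.app .one x) ↔
      X.IsFree ε x ∧ ∀ z, f.left.app .one z = x → Y.IsFree ε (g.left.app .one z) := by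
  have : Mono inl := Adhesive.mono_of_isPushout_of_mono_right h
  refine ⟨fun hx => ⟨hx.of_app, ?_⟩, fun ⟨hX, hY⟩ e he => ?_⟩
  · rintro z rfl
    rw [app_w h] at hx
    exact hx.of_app
  · obtain ⟨e, rfl⟩ | ⟨e, rfl⟩ := eq_inl_or_eq_inr h .zero e <;> rw [map_app] at he
    · exact hX e (app_injective inl _ he)
    · obtain ⟨z, hz, hz'⟩ := exists_of_inr_eq_inl h he
      exact hY z hz e hz'.symm

theorem mem_boundary_inl_iff [Mono g] (h : IsPushout f g inl inr) {ε : EdgeEnd}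
    {x : X.left.Points} : inl.left.app .one x ∈ P.boundary ε ↔
      x ∈ X.boundary ε ∧ ∀ z, f.left.app .one z = x → Y.IsFree ε (g.left.app .one z) := by
  simp only [boundary, Set.mem_ofPred_eq, isEdgePoint_app, isFree_inl_iff h, and_assoc]

theorem boundary_subset_range_inl (h : IsPushout f g inl inr) {ε : EdgeEnd}
    (hY : Y.boundary ε ⊆ Set.range (g.left.app .one)) :
    P.boundary ε ⊆ Set.range (inl.left.app .one) := by
  intro p hp
  obtain hx | ⟨y, rfl⟩ := eq_inl_or_eq_inr h .one p
  · exact hx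
  · obtain ⟨z, rfl⟩ := hY (mem_boundary_of_app hp)
    exact ⟨_, app_w h .one z⟩

theorem nbhd_inl [Mono g] (h : IsPushout f g inl inr) {x : X.left.Points}
    (hx : x ∉ Set.range (f.left.app .one)) :
    P.left.nbhd (inl.left.app .one x) = inl.left.app .zero '' X.left.nbhd x := by
  have : Mono inl := Adhesive.mono_of_isPushout_of_mono_right h
  ext e
  simp only [Graph.mem_nbhd, Set.mem_image]
  constructor
  · rintro ⟨ε, he⟩
    obtain ⟨e, rfl⟩ | ⟨e, rfl⟩ := eq_inl_or_eq_inr h .zero e <;> rw [map_app] at he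
    · exact ⟨e, ⟨ε, app_injective inl _ he⟩, rfl⟩
    · obtain ⟨z, hz, -⟩ := exists_of_inr_eq_inl h he
      exact absurd ⟨z, hz⟩ hx
  · rintro ⟨e, ⟨ε, rfl⟩, rfl⟩
    exact ⟨ε, map_app inl ε e⟩

theorem bijOn_nbhd_inl [Mono g] (h : IsPushout f g inl inr) (hZ : ∀ z, Z.IsEdgePoint z)
    (hX : X.IsLocalIso X.hom) {x : X.left.Points} (hx : X.IsVertex x) :
    Set.BijOn (fun e : P.left.Edges => P.hom.app .zero e) (P.left.nbhd (inl.left.app .one x))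
      ((typeGraph T).nbhd (P.hom.app .one (inl.left.app .one x))) := by
  have : Mono inl := Adhesive.mono_of_isPushout_of_mono_right h
  have hxf : x ∉ Set.range (f.left.app .one) := by
    rintro ⟨z, rfl⟩
    exact (hZ z).not_isVertex ((isVertex_app f).1 hx)
  rw [nbhd_inl h hxf, hom_app_app, ← Set.bijOn_comp_iff (app_injective inl _).injOn]
  exact (hX x hx).congr fun e _ => (hom_app_app inl .zero e).symm

end Pushout

/-- Point-graphs: edgeless graphs all of whose points are edge-points. -/
structure IsPointGraph (G : TGraph T) : Prop where
  isEmpty_edges : IsEmpty G.left.Edges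
  isEdgePoint : ∀ p, G.IsEdgePoint p

/-- A span of monomorphisms out of a point-graph is boundary-coherent if no point of it gets an
in-edge from both sides or an out-edge from both sides. -/
structure IsBoundaryCoherent {Z X Y : TGraph T} (f : Z ⟶ X) (g : Z ⟶ Y) : Prop where
  isPointGraph : Z.IsPointGraph
  mono_left : Mono f
  mono_right : Mono g
  isFree_or_isFree : ∀ (ε : EdgeEnd) z,
    X.IsFree ε (f.left.app .one z) ∨ Y.IsFree ε (g.left.app .one z)

namespace IsBoundaryCoherent

variable {Z X Y P : TGraph T} {f : Z ⟶ X} {g : Z ⟶ Y} {inl : X ⟶ P} {inr : Y ⟶ P}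

theorem symm (hfg : IsBoundaryCoherent f g) : IsBoundaryCoherent g f :=
  ⟨hfg.isPointGraph, hfg.mono_right, hfg.mono_left, fun ε z => (hfg.isFree_or_isFree ε z).symm⟩

theorem of_comp {X' : TGraph T} {i : X ⟶ X'} (h : IsBoundaryCoherent (f ≫ i) g) :
    IsBoundaryCoherent f g where
  isPointGraph := h.isPointGraph
  mono_left := have := h.mono_left; mono_of_mono f i
  mono_right := h.mono_right
  isFree_or_isFree ε z := (h.isFree_or_isFree ε z).imp_left IsFree.of_app

theorem map_inl_ne_map_inr (hfg : IsBoundaryCoherent f g) (h : IsPushout f g inl inr)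
    (ε : EdgeEnd) (e : X.left.Edges) (e' : Y.left.Edges) :
    P.left.map ε (inl.left.app .zero e) ≠ P.left.map ε (inr.left.app .zero e') := by
  have := hfg.mono_left
  simp only [map_app]
  intro hee'
  obtain ⟨z, hz, hz'⟩ := exists_of_inl_eq_inr h hee'
  exact (hfg.isFree_or_isFree ε z).elim (· e hz.symm) (· e' hz'.symm)

theorem eq_of_map_inl_eq (hfg : IsBoundaryCoherent f g) (h : IsPushout f g inl inr)
    (hX : X.IsOpen) {ε : EdgeEnd} {e : X.left.Edges} {e' : P.left.Edges}
    (he : P.IsEdgePoint (P.left.map ε (inl.left.app .zero e)))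
    (hee' : P.left.map ε (inl.left.app .zero e) = P.left.map ε e') :
    inl.left.app .zero e = e' := by
  have := hfg.mono_right
  have : Mono inl := Adhesive.mono_of_isPushout_of_mono_right h
  obtain ⟨e', rfl⟩ | ⟨e', rfl⟩ := eq_inl_or_eq_inr h .zero e'
  · simp only [map_app, isEdgePoint_app] at he hee'
    rw [(isOpen_iff.1 hX).2 ε e e' he (app_injective inl _ hee')]
  · exact absurd hee' (hfg.map_inl_ne_map_inr h ε e e')

theorem isOpen (hfg : IsBoundaryCoherent f g) (h : IsPushout f g inl inr) (hX : X.IsOpen)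
    (hY : Y.IsOpen) : P.IsOpen := by
  have := hfg.mono_left
  have := hfg.mono_right
  have hZ := hfg.isPointGraph.isEdgePoint
  refine isOpen_iff.2 ⟨fun p hp => ?_, fun ε e e' he hee' => ?_⟩
  · obtain ⟨x, rfl⟩ | ⟨y, rfl⟩ := eq_inl_or_eq_inr h .one p
    · exact bijOn_nbhd_inl h hZ hX.localIso ((isVertex_app inl).1 hp)
    · exact bijOn_nbhd_inl h.flip hZ hY.localIso ((isVertex_app inr).1 hp)
  · obtain ⟨e, rfl⟩ | ⟨e, rfl⟩ := eq_inl_or_eq_inr h .zero e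
    · exact hfg.eq_of_map_inl_eq h hX he hee'
    · exact hfg.symm.eq_of_map_inl_eq h.flip hY he hee'

-- Otherwise the openness of `P` identifies an edge of `X` with an edge of `Y`, which then comes
-- from an edge of `Z`.
theorem of_isOpen [Mono f] [Mono g] (hZ : Z.IsPointGraph) (h : IsPushout f g inl inr)
    (hP : P.IsOpen) : IsBoundaryCoherent f g where
  isPointGraph := hZ
  mono_left := inferInstance
  mono_right := inferInstance
  isFree_or_isFree ε z := by
    by_contra! hz
    obtain ⟨⟨e, he⟩, e', he'⟩ := by simpa only [IsFree, not_forall, not_not] using hz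
    have hmap : P.left.map ε (inl.left.app .zero e) = P.left.map ε (inr.left.app .zero e') := by
      rw [map_app, map_app, he, he', app_w h]
    have hedge : P.IsEdgePoint (P.left.map ε (inl.left.app .zero e)) := by
      simpa only [map_app, he, isEdgePoint_app] using hZ.isEdgePoint z
    obtain ⟨z, -⟩ := exists_of_inl_eq_inr h ((isOpen_iff.1 hP).2 ε _ _ hedge hmap)
    exact hZ.isEmpty_edges.elim z

end IsBoundaryCoherent

end TGraph

open TGraph

section Hom

variable {Z G H : OGraph T}

instance (f : G ⟶ H) [Mono f.hom] : Mono ((embedding T).map f) := ‹Mono f.hom›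

theorem mono_of_mono_hom (f : G ⟶ H) [Mono f.hom] : Mono f :=
  (embedding T).mono_of_mono_map inferInstance

-- Points `z`, `z'` with the same image are not separated by the endomorphism of `Z` that moves `z`
-- to `z'` and fixes all other points.
theorem mono_hom_of_isEmpty [IsEmpty Z.Edges] (f : Z ⟶ G) [Mono f] : Mono f.hom := by
  classical
  refine mono_of_injective_of_isEmpty fun z z' hz => ?_
  have htype : Z.obj.typeOf z' = Z.obj.typeOf z := by
    simpa only [typeOf, hom_app_app] using congrArg G.obj.typeOf hz.symm
  let u : Z ⟶ Z := ObjectProperty.homMk <| homOfIsEmpty (Function.update id z z') fun x => by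
    obtain rfl | hx := eq_or_ne x z <;> simp [*]
  have hu : u = 𝟙 Z := by
    rw [← cancel_mono f]
    refine ObjectProperty.hom_ext _ (hom_ext_of_isEmpty fun x => ?_)
    change f.hom.left.app .one (Function.update id z z' x) = f.hom.left.app .one x
    obtain rfl | hx := eq_or_ne x z <;> simp [*]
  calc z = u.hom.left.app .one z := by rw [hu]; rfl
    _ = Function.update id z z' z := rfl
    _ = z' := Function.update_self ..

theorem exists_comp_eq_of_range_subset [IsEmpty Z.Edges] (d : Z ⟶ H) (s : G ⟶ H)
    (h : Set.range (OGraph.onPoints d) ⊆ Set.range (OGraph.onPoints s)) :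
    ∃ d' : Z ⟶ G, d' ≫ s = d := by
  choose φ hφ using fun z => h ⟨z, rfl⟩
  refine ⟨ObjectProperty.homMk (homOfIsEmpty φ fun z => ?_),
    ObjectProperty.hom_ext _ (hom_ext_of_isEmpty hφ)⟩
  simpa only [typeOf, OGraph.onPoints, hom_app_app] using congrArg H.obj.typeOf (hφ z)

theorem bijOn_onPoints_comp_iff (d : Z ⟶ G) (s : G ⟶ H) [Mono s.hom] {A : Set Z.Points}
    {V : Set H.Points} (hV : V ⊆ Set.range (OGraph.onPoints s)) :
    Set.BijOn (OGraph.onPoints (d ≫ s)) A V ↔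
      Set.BijOn (OGraph.onPoints d) A (OGraph.onPoints s ⁻¹' V) :=
  bijOn_comp_iff_bijOn_preimage (app_injective s.hom .one) hV

end Hom

section AdhesivePushout

variable {Z X Y P : OGraph T} {f : Z ⟶ X} {g : Z ⟶ Y} {inl : X ⟶ P} {inr : Y ⟶ P}

theorem IsAdhesivePushout.of_preserved (h : IsPushout f.hom g.hom inl.hom inr.hom) :
    IsAdhesivePushout f g inl inr :=
  ⟨IsPushout.of_map_of_faithful (embedding T) h, h⟩

theorem IsAdhesivePushout.flip (h : IsAdhesivePushout f g inl inr) :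
    IsAdhesivePushout g f inr inl :=
  ⟨h.isPushout.flip, h.preserved.flip⟩

theorem IsAdhesivePushout.isPushout_hom (h : IsAdhesivePushout f g inl inr) :
    IsPushout f.hom g.hom inl.hom inr.hom :=
  h.preserved

theorem IsAdhesivePushout.isBoundaryCoherent [Mono f.hom] [Mono g.hom]
    (h : IsAdhesivePushout f g inl inr) (hZ : Z.obj.IsPointGraph) :
    IsBoundaryCoherent f.hom g.hom :=
  .of_isOpen hZ h.isPushout_hom P.property

theorem IsAdhesivePushout.mono_inl_hom [Mono g.hom] (h : IsAdhesivePushout f g inl inr) :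
    Mono inl.hom :=
  Adhesive.mono_of_isPushout_of_mono_right h.isPushout_hom

theorem IsAdhesivePushout.mono_inr_hom [Mono f.hom] (h : IsAdhesivePushout f g inl inr) :
    Mono inr.hom :=
  h.flip.mono_inl_hom

theorem IsAdhesivePushout.bijOn_comp_inl [Mono g.hom] (h : IsAdhesivePushout f g inl inr)
    {W : OGraph T} {d : W ⟶ X} {S : Set W.Points} {ε : EdgeEnd}
    (hd : Set.BijOn (OGraph.onPoints d) S (X.obj.boundary ε))
    (hg : Set.BijOn (OGraph.onPoints g) Set.univ (Y.obj.boundary ε)) :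
    Set.BijOn (OGraph.onPoints (d ≫ inl)) S (P.obj.boundary ε) := by
  have := h.mono_inl_hom
  have hinl : OGraph.onPoints inl ⁻¹' P.obj.boundary ε = X.obj.boundary ε := by
    ext x
    exact (mem_boundary_inl_iff h.isPushout_hom).trans
      (and_iff_left fun z _ => (hg.mapsTo (Set.mem_univ z)).2)
  rw [← hinl] at hd
  exact (bijOn_onPoints_comp_iff d inl (boundary_subset_range_inl h.isPushout_hom
    (hg.surjOn.trans (Set.image_subset_range _ _)))).2 hd

theorem exists_isAdhesivePushout (hfg : IsBoundaryCoherent f.hom g.hom) :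
    ∃ (P : OGraph T) (inl : X ⟶ P) (inr : Y ⟶ P), IsAdhesivePushout f g inl inr :=
  have h := IsPushout.of_hasPushout f.hom g.hom
  ⟨⟨pushout f.hom g.hom, hfg.isOpen h X.property Y.property⟩,
    ObjectProperty.homMk (pushout.inl _ _), ObjectProperty.homMk (pushout.inr _ _),
    .of_preserved h⟩

theorem isAdhesivePushout_of_isPushout (hfg : IsBoundaryCoherent f.hom g.hom)
    (h : IsPushout f g inl inr) : IsAdhesivePushout f g inl inr := by
  obtain ⟨P', inl', inr', h'⟩ := exists_isAdhesivePushout hfg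
  let e := h'.isPushout.isoIsPushout _ _ h
  have hinl : inl'.hom ≫ e.hom.hom = inl.hom :=
    congrArg (·.hom) (h'.isPushout.inl_isoIsPushout_hom _ _ h)
  have hinr : inr'.hom ≫ e.hom.hom = inr.hom :=
    congrArg (·.hom) (h'.isPushout.inr_isoIsPushout_hom _ _ h)
  exact ⟨h, h'.isPushout_hom.of_iso (Iso.refl _) (Iso.refl _) (Iso.refl _) ((embedding T).mapIso e)
    (by simp) (by simp) (by simpa using hinl) (by simpa using hinr)⟩

theorem IsAdhesivePushout.extend {B L K G W H P K' : OGraph T} {b : B ⟶ L} {k : B ⟶ K}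
    {m : L ⟶ G} {s : K ⟶ G} (hG : IsAdhesivePushout b k m s) {c : W ⟶ K} {f : W ⟶ H}
    {i : G ⟶ P} {v : K' ⟶ P} {t : K ⟶ K'} {r : H ⟶ K'} (hK : IsAdhesivePushout c f t r)
    (hP : IsAdhesivePushout (c ≫ s) f i (r ≫ v)) (hv : t ≫ v = s ≫ i) :
    IsAdhesivePushout b (k ≫ t) (m ≫ i) v :=
  .of_preserved (hG.isPushout_hom.paste_vert
    (hP.isPushout_hom.of_left (congrArg (·.hom) hv.symm) hK.isPushout_hom))

theorem IsAdhesivePushout.exists_iso_complement {B L K K' G : OGraph T} {b : B ⟶ L} [Mono b.hom]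
    {k : B ⟶ K} {m : L ⟶ G} {s : K ⟶ G} {k' : B ⟶ K'} {s' : K' ⟶ G}
    (h : IsAdhesivePushout b k m s) (h' : IsAdhesivePushout b k' m s') :
    ∃ φ : K ≅ K', k ≫ φ.hom = k' ∧ φ.hom ≫ s' = s := by
  obtain ⟨φ, hk, hs⟩ := exists_iso_of_isPushoutComplement h.isPushout_hom h'.isPushout_hom
  exact ⟨ObjectProperty.isoMk _ φ, ObjectProperty.hom_ext _ hk, ObjectProperty.hom_ext _ hs⟩

end AdhesivePushout

namespace RewriteRule

variable (ρ : RewriteRule T)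

instance : Mono ρ.b₁.hom :=
  have := ρ.mono₁
  have := ρ.noEdges
  mono_hom_of_isEmpty ρ.b₁

instance : Mono ρ.b₂.hom :=
  have := ρ.mono₂
  have := ρ.noEdges
  mono_hom_of_isEmpty ρ.b₂

theorem isPointGraph : ρ.B.obj.IsPointGraph where
  isEmpty_edges := ρ.noEdges
  isEdgePoint z := by
    obtain ⟨I, hin, hout, -⟩ := ρ.sameBoundary
    refine (isEdgePoint_app ρ.b₁.hom).1 ?_
    by_cases hz : z ∈ I
    · exact (hin.mapsTo hz).1
    · exact (hout.mapsTo hz).1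

theorem exists_bijOn_boundary (ε : EdgeEnd) : ∃ I : Set ρ.B.Points,
    Set.BijOn (ρ.b₁.hom.left.app .one) I (ρ.L.obj.boundary ε) ∧
    Set.BijOn (ρ.b₂.hom.left.app .one) I (ρ.R.obj.boundary ε) := by
  obtain ⟨I, hinL, houtL, hinR, houtR⟩ := ρ.sameBoundary
  cases ε
  · exact ⟨Iᶜ, houtL, houtR⟩
  · exact ⟨I, hinL, hinR⟩

theorem boundary_subset_range_b₁ (ε : EdgeEnd) :
    ρ.L.obj.boundary ε ⊆ Set.range (ρ.b₁.hom.left.app .one) :=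
  have ⟨_, h, _⟩ := ρ.exists_bijOn_boundary ε
  h.surjOn.trans (Set.image_subset_range _ _)

theorem boundary_subset_range_b₂ (ε : EdgeEnd) :
    ρ.R.obj.boundary ε ⊆ Set.range (ρ.b₂.hom.left.app .one) :=
  have ⟨_, _, h⟩ := ρ.exists_bijOn_boundary ε
  h.surjOn.trans (Set.image_subset_range _ _)

theorem isFree_b₁_iff_isFree_b₂ {ε : EdgeEnd} {z : ρ.B.Points} :
    ρ.L.obj.IsFree ε (ρ.b₁.hom.left.app .one z) ↔ ρ.R.obj.IsFree ε (ρ.b₂.hom.left.app .one z) := by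
  obtain ⟨I, hL, hR⟩ := ρ.exists_bijOn_boundary ε
  have hz := ρ.isPointGraph.isEdgePoint z
  calc _ ↔ ρ.b₁.hom.left.app .one z ∈ ρ.L.obj.boundary ε :=
        (and_iff_right ((isEdgePoint_app _).2 hz)).symm
    _ ↔ z ∈ I := hL.image_eq ▸ (app_injective ρ.b₁.hom .one).mem_set_image
    _ ↔ ρ.b₂.hom.left.app .one z ∈ ρ.R.obj.boundary ε :=
        (hR.image_eq ▸ (app_injective ρ.b₂.hom .one).mem_set_image).symm
    _ ↔ _ := and_iff_right ((isEdgePoint_app _).2 hz)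

/-- The double pushout diagram of the rule `ρ`, with matching `m`, complement `K` of `m` and result
`G'`; both squares are adhesive pushouts. -/
structure IsDoublePushout (ρ : RewriteRule T) {K G G' : OGraph T} (k : ρ.B ⟶ K) (m : ρ.L ⟶ G)
    (s : K ⟶ G) (n : ρ.R ⟶ G') (s' : K ⟶ G') : Prop where
  mono : Mono m
  left : IsAdhesivePushout ρ.b₁ k m s
  right : IsAdhesivePushout ρ.b₂ k n s'

theorem mono_hom_of_isAdhesivePushout {ρ : RewriteRule T} {K G : OGraph T} {k : ρ.B ⟶ K}
    {m : ρ.L ⟶ G} {s : K ⟶ G} [Mono m] (h : IsAdhesivePushout ρ.b₁ k m s) : Mono k.hom := by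
  have := ρ.mono₁
  have := ρ.noEdges
  have : Mono (k ≫ s) := h.isPushout.w ▸ mono_comp ρ.b₁ m
  have := mono_of_mono k s
  exact mono_hom_of_isEmpty k

theorem exists_isDoublePushout {ρ : RewriteRule T} {G : OGraph T} {m : ρ.L ⟶ G}
    (hm : IsMatching ρ m) : ∃ (K G' : OGraph T) (k : ρ.B ⟶ K) (s : K ⟶ G) (n : ρ.R ⟶ G')
      (s' : K ⟶ G'), ρ.IsDoublePushout k m s n s' := by
  obtain ⟨hm, K, k, s, h⟩ := hm
  have : Mono k.hom := mono_hom_of_isAdhesivePushout h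
  have hL := h.isBoundaryCoherent ρ.isPointGraph
  have hR : IsBoundaryCoherent ρ.b₂.hom k.hom :=
    ⟨ρ.isPointGraph, inferInstance, inferInstance, fun ε z =>
      (hL.isFree_or_isFree ε z).imp_left ρ.isFree_b₁_iff_isFree_b₂.1⟩
  obtain ⟨G', n, s', h'⟩ := exists_isAdhesivePushout hR
  exact ⟨K, G', k, s, n, s', hm, h, h'⟩

namespace IsDoublePushout

variable {ρ : RewriteRule T} {K G G' : OGraph T} {k : ρ.B ⟶ K} {m : ρ.L ⟶ G} {s : K ⟶ G}
  {n : ρ.R ⟶ G'} {s' : K ⟶ G'}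

theorem isMatching (h : ρ.IsDoublePushout k m s n s') : IsMatching ρ m :=
  ⟨h.mono, K, k, s, h.left⟩

theorem boundary_subset_range_left (h : ρ.IsDoublePushout k m s n s') (ε : EdgeEnd) :
    G.obj.boundary ε ⊆ Set.range (OGraph.onPoints s) :=
  boundary_subset_range_inl h.left.isPushout_hom.flip (ρ.boundary_subset_range_b₁ ε)

theorem boundary_subset_range_right (h : ρ.IsDoublePushout k m s n s') (ε : EdgeEnd) :
    G'.obj.boundary ε ⊆ Set.range (OGraph.onPoints s') :=
  boundary_subset_range_inl h.right.isPushout_hom.flip (ρ.boundary_subset_range_b₂ ε)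

theorem preimage_boundary (h : ρ.IsDoublePushout k m s n s') (ε : EdgeEnd) :
    OGraph.onPoints s ⁻¹' G.obj.boundary ε = OGraph.onPoints s' ⁻¹' G'.obj.boundary ε := by
  ext p
  calc s.hom.left.app .one p ∈ G.obj.boundary ε
    _ ↔ _ := mem_boundary_inl_iff h.left.isPushout_hom.flip
    _ ↔ _ := by simp only [isFree_b₁_iff_isFree_b₂]
    _ ↔ s'.hom.left.app .one p ∈ G'.obj.boundary ε :=
        (mem_boundary_inl_iff h.right.isPushout_hom.flip).symm

theorem noIsolatedPoints_iff (h : ρ.IsDoublePushout k m s n s') :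
    G.NoIsolatedPoints ↔ G'.NoIsolatedPoints :=
  calc Disjoint (G.obj.boundary .right) (G.obj.boundary .left)
    _ ↔ Disjoint (OGraph.onPoints s ⁻¹' G.obj.boundary .right)
          (OGraph.onPoints s ⁻¹' G.obj.boundary .left) :=
        disjoint_iff_disjoint_preimage (h.boundary_subset_range_left _)
    _ ↔ Disjoint (OGraph.onPoints s' ⁻¹' G'.obj.boundary .right)
          (OGraph.onPoints s' ⁻¹' G'.obj.boundary .left) := by
        rw [h.preimage_boundary, h.preimage_boundary]
    _ ↔ Disjoint (G'.obj.boundary .right) (G'.obj.boundary .left) :=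
        (disjoint_iff_disjoint_preimage (h.boundary_subset_range_right _)).symm

theorem exists_leg (h : ρ.IsDoublePushout k m s n s') {W : OGraph T} [IsEmpty W.Edges] {d : W ⟶ G}
    {ε : EdgeEnd} (hd : Set.BijOn (OGraph.onPoints d) Set.univ (G.obj.boundary ε)) :
    ∃ d' : W ⟶ K, d' ≫ s = d ∧
      Set.BijOn (OGraph.onPoints (d' ≫ s')) Set.univ (G'.obj.boundary ε) := by
  obtain ⟨d', rfl⟩ := exists_comp_eq_of_range_subset d s <|
    (Set.range_subset_iff.2 fun w => hd.mapsTo (Set.mem_univ w)).trans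
      (h.boundary_subset_range_left ε)
  have := h.left.mono_inr_hom
  have := h.right.mono_inr_hom
  refine ⟨d', rfl, (bijOn_onPoints_comp_iff d' s' (h.boundary_subset_range_right ε)).2 ?_⟩
  rw [← h.preimage_boundary]
  exact (bijOn_onPoints_comp_iff d' s (h.boundary_subset_range_left ε)).1 hd

theorem exists_iso (h : ρ.IsDoublePushout k m s n s') {K₂ G₂' : OGraph T} {k₂ : ρ.B ⟶ K₂}
    {s₂ : K₂ ⟶ G} {n₂ : ρ.R ⟶ G₂'} {s₂' : K₂ ⟶ G₂'} (h₂ : ρ.IsDoublePushout k₂ m s₂ n₂ s₂') :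
    ∃ (φ : K ≅ K₂) (e : G' ≅ G₂'), φ.hom ≫ s₂ = s ∧ s' ≫ e.hom = φ.hom ≫ s₂' := by
  obtain ⟨φ, hk, hs⟩ := h.left.exists_iso_complement h₂.left
  obtain ⟨e, he⟩ := exists_iso_of_isPushout_of_iso h.right.isPushout h₂.right.isPushout φ hk
  exact ⟨φ, e, hs, he⟩

theorem extend (h : ρ.IsDoublePushout k m s n s') {W H P P' : OGraph T} {c : W ⟶ K} {f : W ⟶ H}
    {i : G ⟶ P} {j : H ⟶ P} {i' : G' ⟶ P'} {j' : H ⟶ P'}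
    (hcf : IsBoundaryCoherent (c ≫ s).hom f.hom) (hP : IsAdhesivePushout (c ≫ s) f i j)
    (hP' : IsAdhesivePushout (c ≫ s') f i' j') :
    ∃ (K' : OGraph T) (t : K ⟶ K') (r : H ⟶ K') (v : K' ⟶ P) (v' : K' ⟶ P'),
      (t ≫ v = s ≫ i ∧ r ≫ v = j) ∧ (t ≫ v' = s' ≫ i' ∧ r ≫ v' = j') ∧
        ρ.IsDoublePushout (k ≫ t) (m ≫ i) v (n ≫ i') v' := by
  have := hcf.mono_right
  have := hP.mono_inl_hom
  have := h.mono
  have := mono_of_mono_hom i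
  obtain ⟨K', t, r, hK⟩ := exists_isAdhesivePushout hcf.of_comp
  obtain ⟨v, htv, rfl⟩ :=
    hK.isPushout.exists_desc (s ≫ i) j ((Category.assoc ..).symm.trans hP.isPushout.w)
  obtain ⟨v', htv', rfl⟩ :=
    hK.isPushout.exists_desc (s' ≫ i') j' ((Category.assoc ..).symm.trans hP'.isPushout.w)
  exact ⟨K', t, r, v, v', ⟨htv, rfl⟩, ⟨htv', rfl⟩, mono_comp m i, h.left.extend hK hP htv,
    h.right.extend hK hP' htv'⟩

end IsDoublePushout

end RewriteRule

instance (X : List O) : IsEmpty (pointGraph T X).Edges := inferInstanceAs (IsEmpty PEmpty)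

theorem isPointGraph_pointGraph (X : List O) : (pointGraph T X).obj.IsPointGraph :=
  ⟨inferInstance, fun x => ⟨X.get x.down, rfl⟩⟩

namespace DCospan

variable {W X Y Z : List O}

section Composition

variable {𝒢 𝒢' : DCospan T X Y} {ℋ ℋ' : DCospan T Y Z} {𝒦 𝒦' : DCospan T X Z}

instance (𝒢 : DCospan T X Y) : Mono 𝒢.dom.hom :=
  mono_of_injective_of_isEmpty (Set.injOn_univ.1 𝒢.dom_bij.injOn)

instance (𝒢 : DCospan T X Y) : Mono 𝒢.cod.hom :=
  mono_of_injective_of_isEmpty (Set.injOn_univ.1 𝒢.cod_bij.injOn)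

theorem isBoundaryCoherent_cod_dom (𝒢 : DCospan T X Y) (ℋ : DCospan T Y Z) :
    IsBoundaryCoherent 𝒢.cod.hom ℋ.dom.hom where
  isPointGraph := isPointGraph_pointGraph Y
  mono_left := inferInstance
  mono_right := inferInstance
  isFree_or_isFree
    | .left, y => .inl (𝒢.cod_bij.mapsTo (Set.mem_univ y)).2
    | .right, y => .inr (ℋ.dom_bij.mapsTo (Set.mem_univ y)).2

theorem isAdhesivePushout_of_isPushout_cod_dom {P : OGraph T} {i : 𝒢.graph ⟶ P} {j : ℋ.graph ⟶ P}
    (h : IsPushout 𝒢.cod ℋ.dom i j) : IsAdhesivePushout 𝒢.cod ℋ.dom i j :=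
  isAdhesivePushout_of_isPushout (isBoundaryCoherent_cod_dom 𝒢 ℋ) h

theorem exists_isComp (𝒢 : DCospan T X Y) (ℋ : DCospan T Y Z) : ∃ 𝒦, IsComp 𝒢 ℋ 𝒦 := by
  obtain ⟨P, i, j, h⟩ := exists_isAdhesivePushout (isBoundaryCoherent_cod_dom 𝒢 ℋ)
  exact ⟨⟨P, 𝒢.dom ≫ i, ℋ.cod ≫ j, h.bijOn_comp_inl (ε := .right) 𝒢.dom_bij ℋ.dom_bij,
    h.flip.bijOn_comp_inl (ε := .left) ℋ.cod_bij 𝒢.cod_bij⟩, i, j, h.isPushout, rfl, rfl⟩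

/-- The composite `ℋ ∘ 𝒢` of directed cospans, on a chosen pushout. -/
noncomputable def comp (𝒢 : DCospan T X Y) (ℋ : DCospan T Y Z) : DCospan T X Z :=
  (exists_isComp 𝒢 ℋ).choose

theorem isComp_comp (𝒢 : DCospan T X Y) (ℋ : DCospan T Y Z) : IsComp 𝒢 ℋ (𝒢.comp ℋ) :=
  (exists_isComp 𝒢 ℋ).choose_spec

theorem IsComp.unique : IsComp 𝒢 ℋ 𝒦 → IsComp 𝒢 ℋ 𝒦' → Iso 𝒦 𝒦' := by
  rintro ⟨i, j, h, hd, hc⟩ ⟨i', j', h', hd', hc'⟩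
  exact ⟨h.isoIsPushout _ _ h', by simp [hd, hd'], by simp [hc, hc']⟩

theorem IsComp.of_iso_left : IsComp 𝒢 ℋ 𝒦 → Iso 𝒢 𝒢' → IsComp 𝒢' ℋ 𝒦 := by
  rintro ⟨i, j, h, hd, hc⟩ ⟨e, he, he'⟩
  refine ⟨e.inv ≫ i, j, ?_, by simp [hd, ← he], hc⟩
  exact h.of_iso (CategoryTheory.Iso.refl _) e (CategoryTheory.Iso.refl _)
    (CategoryTheory.Iso.refl _) (by simp [he']) (by simp) (by simp) (by simp)

theorem IsComp.of_iso_right : IsComp 𝒢 ℋ 𝒦 → Iso ℋ ℋ' → IsComp 𝒢 ℋ' 𝒦 := by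
  rintro ⟨i, j, h, hd, hc⟩ ⟨e, he, he'⟩
  refine ⟨i, e.inv ≫ j, ?_, hd, by simp [hc, ← he']⟩
  exact h.of_iso (CategoryTheory.Iso.refl _) (CategoryTheory.Iso.refl _) e
    (CategoryTheory.Iso.refl _) (by simp) (by simp [he]) (by simp) (by simp)

theorem isComp_identity_left (𝒢 : DCospan T X Y) : IsComp (identity X) 𝒢 𝒢 :=
  ⟨𝒢.dom, 𝟙 _, IsPushout.of_id_fst, (Category.id_comp _).symm, (Category.comp_id _).symm⟩

theorem isComp_identity_right (𝒢 : DCospan T X Y) : IsComp 𝒢 (identity Y) 𝒢 :=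
  ⟨𝟙 _, 𝒢.cod, IsPushout.of_id_snd, (Category.comp_id _).symm, (Category.id_comp _).symm⟩

theorem IsComp.assoc {𝒜 : DCospan T W X} {𝒜𝒢 : DCospan T W Y} {𝒢ℋ : DCospan T X Z}
    {𝒜𝒢ℋ : DCospan T W Z} :
    IsComp 𝒜 𝒢 𝒜𝒢 → IsComp 𝒢 ℋ 𝒢ℋ → IsComp 𝒜𝒢 ℋ 𝒜𝒢ℋ → IsComp 𝒜 𝒢ℋ 𝒜𝒢ℋ := by
  rintro ⟨i, j, h, hd, hc⟩ ⟨i', j', h', hd', hc'⟩ ⟨i'', j'', h'', hd'', hc''⟩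
  rw [hc] at h''
  obtain ⟨v, hi, hj⟩ :=
    h'.exists_desc (j ≫ i'') j'' ((Category.assoc ..).symm.trans h''.w)
  refine ⟨i ≫ i'', v, ?_, by rw [hd'', hd, Category.assoc], by rw [hc'', hc', Category.assoc, hj]⟩
  rw [hd']
  exact h.paste_vert (.of_left (by rwa [hj]) hi.symm h')

theorem IsComp.noIsolatedPoints (h𝒢 : 𝒢.graph.NoIsolatedPoints) :
    IsComp 𝒢 ℋ 𝒦 → 𝒦.graph.NoIsolatedPoints := by
  rintro ⟨i, j, h, -, -⟩
  have hi : 𝒦.graph.obj.boundary .right ⊆ Set.range (OGraph.onPoints i) :=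
    boundary_subset_range_inl (isAdhesivePushout_of_isPushout_cod_dom h).isPushout_hom
      (ℋ.dom_bij.surjOn.trans (Set.image_subset_range _ _))
  refine (disjoint_iff_disjoint_preimage hi).2 (h𝒢.mono ?_ ?_)
  · exact fun x => mem_boundary_of_app (ε := .right)
  · exact fun x => mem_boundary_of_app (ε := .left)

end Composition

section Rewriting

variable {ρ : RewriteRule T} {𝒢 𝒢' 𝒢'' : DCospan T X Y} {ℋ ℋ' : DCospan T Y Z}
  {𝒦 𝒦' : DCospan T X Z}

theorem isRewrite_iff {m : ρ.L ⟶ 𝒢.graph} : IsRewrite ρ 𝒢 m 𝒢' ↔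
    ∃ (K : OGraph T) (k : ρ.B ⟶ K) (s : K ⟶ 𝒢.graph) (n : ρ.R ⟶ 𝒢'.graph) (s' : K ⟶ 𝒢'.graph)
      (d : pointGraph T X ⟶ K) (c : pointGraph T Y ⟶ K), ρ.IsDoublePushout k m s n s' ∧
        (d ≫ s = 𝒢.dom ∧ d ≫ s' = 𝒢'.dom) ∧ c ≫ s = 𝒢.cod ∧ c ≫ s' = 𝒢'.cod := by
  constructor
  · rintro ⟨hm, K, k, s, s', n, h, h', ⟨d, hd⟩, c, hc⟩
    exact ⟨K, k, s, n, s', d, c, ⟨hm.1, h, h'⟩, hd, hc⟩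
  · rintro ⟨K, k, s, n, s', d, c, h, hd, hc⟩
    exact ⟨h.isMatching, K, k, s, s', n, h.left, h.right, ⟨d, hd⟩, c, hc⟩

theorem exists_isRewrite {m : ρ.L ⟶ 𝒢.graph} (hm : IsMatching ρ m) :
    ∃ 𝒢', IsRewrite ρ 𝒢 m 𝒢' := by
  obtain ⟨K, G', k, s, n, s', h⟩ := RewriteRule.exists_isDoublePushout hm
  obtain ⟨d, hd, hd'⟩ := h.exists_leg (ε := .right) 𝒢.dom_bij
  obtain ⟨c, hc, hc'⟩ := h.exists_leg (ε := .left) 𝒢.cod_bij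
  exact ⟨⟨G', d ≫ s', c ≫ s', hd', hc'⟩,
    isRewrite_iff.2 ⟨K, k, s, n, s', d, c, h, ⟨hd, rfl⟩, hc, rfl⟩⟩

theorem IsRewrite.unique {m : ρ.L ⟶ 𝒢.graph} (h𝒢' : IsRewrite ρ 𝒢 m 𝒢')
    (h𝒢'' : IsRewrite ρ 𝒢 m 𝒢'') : Iso 𝒢' 𝒢'' := by
  obtain ⟨K₁, k₁, s₁, n₁, s₁', d₁, c₁, h₁, ⟨hd₁, hd₁'⟩, hc₁, hc₁'⟩ := isRewrite_iff.1 h𝒢'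
  obtain ⟨K₂, k₂, s₂, n₂, s₂', d₂, c₂, h₂, ⟨hd₂, hd₂'⟩, hc₂, hc₂'⟩ := isRewrite_iff.1 h𝒢''
  obtain ⟨φ, e, hφ, he⟩ := h₁.exists_iso h₂
  have := h₂.left.mono_inr_hom
  have := mono_of_mono_hom s₂
  have hd : d₁ ≫ φ.hom = d₂ := by rw [← cancel_mono s₂, Category.assoc, hφ, hd₁, hd₂]
  have hc : c₁ ≫ φ.hom = c₂ := by rw [← cancel_mono s₂, Category.assoc, hφ, hc₁, hc₂]
  refine ⟨e, ?_, ?_⟩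
  · rw [← hd₁', ← hd₂', Category.assoc, he, ← hd, Category.assoc]
  · rw [← hc₁', ← hc₂', Category.assoc, he, ← hc, Category.assoc]

theorem IsRewrite.noIsolatedPoints_iff {m : ρ.L ⟶ 𝒢.graph} (h : IsRewrite ρ 𝒢 m 𝒢') :
    𝒢.graph.NoIsolatedPoints ↔ 𝒢'.graph.NoIsolatedPoints := by
  obtain ⟨_, _, _, _, _, _, _, h, -⟩ := isRewrite_iff.1 h
  exact h.noIsolatedPoints_iff

theorem IsRewrite.comp_left {m : ρ.L ⟶ 𝒢.graph} {i : 𝒢.graph ⟶ 𝒦.graph} {j : ℋ.graph ⟶ 𝒦.graph}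
    (hij : IsPushout 𝒢.cod ℋ.dom i j) (hdom : 𝒦.dom = 𝒢.dom ≫ i) (hcod : 𝒦.cod = ℋ.cod ≫ j)
    (h𝒢' : IsRewrite ρ 𝒢 m 𝒢') (h𝒦' : IsComp 𝒢' ℋ 𝒦') : IsRewrite ρ 𝒦 (m ≫ i) 𝒦' := by
  obtain ⟨K, k, s, n, s', d, c, h, ⟨hd, hd'⟩, hc, hc'⟩ := isRewrite_iff.1 h𝒢'
  obtain ⟨i', j', hij', hdom', hcod'⟩ := h𝒦'
  obtain ⟨K', t, r, v, v', ⟨hv, hr⟩, ⟨hv', hr'⟩, hK'⟩ := h.extend (c := c) (f := ℋ.dom)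
    (hc ▸ isBoundaryCoherent_cod_dom 𝒢 ℋ) (hc ▸ isAdhesivePushout_of_isPushout_cod_dom hij)
    (hc' ▸ isAdhesivePushout_of_isPushout_cod_dom hij')
  refine isRewrite_iff.2 ⟨K', k ≫ t, v, n ≫ i', v', d ≫ t, ℋ.cod ≫ r, hK', ⟨?_, ?_⟩, ?_, ?_⟩
  · rw [Category.assoc, hv, hdom, ← hd, Category.assoc]
  · rw [Category.assoc, hv', hdom', ← hd', Category.assoc]
  · rw [Category.assoc, hr, hcod]
  · rw [Category.assoc, hr', hcod']

theorem IsRewrite.comp_right {n : ρ.L ⟶ ℋ.graph} {i : 𝒢.graph ⟶ 𝒦.graph} {j : ℋ.graph ⟶ 𝒦.graph}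
    (hij : IsPushout 𝒢.cod ℋ.dom i j) (hdom : 𝒦.dom = 𝒢.dom ≫ i) (hcod : 𝒦.cod = ℋ.cod ≫ j)
    (hℋ' : IsRewrite ρ ℋ n ℋ') (h𝒦' : IsComp 𝒢 ℋ' 𝒦') : IsRewrite ρ 𝒦 (n ≫ j) 𝒦' := by
  obtain ⟨K, k, s, n', s', d, c, h, ⟨hd, hd'⟩, hc, hc'⟩ := isRewrite_iff.1 hℋ'
  obtain ⟨i', j', hij', hdom', hcod'⟩ := h𝒦'
  obtain ⟨K', t, r, v, v', ⟨hv, hr⟩, ⟨hv', hr'⟩, hK'⟩ := h.extend (c := d) (f := 𝒢.cod)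
    (hd ▸ (isBoundaryCoherent_cod_dom 𝒢 ℋ).symm)
    (hd ▸ (isAdhesivePushout_of_isPushout_cod_dom hij).flip)
    (hd' ▸ (isAdhesivePushout_of_isPushout_cod_dom hij').flip)
  refine isRewrite_iff.2 ⟨K', k ≫ t, v, n' ≫ j', v', 𝒢.dom ≫ r, c ≫ t, hK', ⟨?_, ?_⟩, ?_, ?_⟩
  · rw [Category.assoc, hr, hdom]
  · rw [Category.assoc, hr', hdom']
  · rw [Category.assoc, hv, hcod, ← hc, Category.assoc]
  · rw [Category.assoc, hv', hcod', ← hc', Category.assoc]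

theorem exists_matching_comp_left {m : ρ.L ⟶ 𝒢.graph} (hm : IsMatching ρ m) :
    IsComp 𝒢 ℋ 𝒦 → ∃ m' : ρ.L ⟶ 𝒦.graph, IsMatching ρ m' ∧
      ∀ 𝒢' 𝒦', IsRewrite ρ 𝒢 m 𝒢' → IsComp 𝒢' ℋ 𝒦' → IsRewrite ρ 𝒦 m' 𝒦' := by
  rintro ⟨i, j, hij, hdom, hcod⟩
  obtain ⟨𝒢', h𝒢'⟩ := exists_isRewrite hm
  exact ⟨m ≫ i, (h𝒢'.comp_left hij hdom hcod (isComp_comp 𝒢' ℋ)).1,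
    fun _ _ => .comp_left hij hdom hcod⟩

theorem exists_matching_comp_right {n : ρ.L ⟶ ℋ.graph} (hn : IsMatching ρ n) :
    IsComp 𝒢 ℋ 𝒦 → ∃ n' : ρ.L ⟶ 𝒦.graph, IsMatching ρ n' ∧
      ∀ ℋ' 𝒦', IsRewrite ρ ℋ n ℋ' → IsComp 𝒢 ℋ' 𝒦' → IsRewrite ρ 𝒦 n' 𝒦' := by
  rintro ⟨i, j, hij, hdom, hcod⟩
  obtain ⟨ℋ', hℋ'⟩ := exists_isRewrite hn
  exact ⟨n ≫ j, (hℋ'.comp_right hij hdom hcod (isComp_comp 𝒢 ℋ')).1,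
    fun _ _ => .comp_right hij hdom hcod⟩

end Rewriting

section Congruence

variable {𝕊 : Set (RewriteRule T)} {𝒢 𝒢' : DCospan T X Y} {ℋ ℋ' : DCospan T Y Z}

theorem Iso.rewriteEquiv (h : Iso 𝒢 𝒢') : RewriteEquiv 𝕊 𝒢 𝒢' :=
  .rel _ _ (.inl h)

theorem RewritesTo.rewriteEquiv (h : RewritesTo 𝕊 𝒢 𝒢') : RewriteEquiv 𝕊 𝒢 𝒢' :=
  .rel _ _ (.inr h)

theorem Iso.comp_left (h : Iso 𝒢 𝒢') : Iso (𝒢.comp ℋ) (𝒢'.comp ℋ) :=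
  ((isComp_comp 𝒢 ℋ).of_iso_left h).unique (isComp_comp 𝒢' ℋ)

theorem Iso.comp_right (h : Iso ℋ ℋ') : Iso (𝒢.comp ℋ) (𝒢.comp ℋ') :=
  ((isComp_comp 𝒢 ℋ).of_iso_right h).unique (isComp_comp 𝒢 ℋ')

theorem RewritesTo.comp_left : RewritesTo 𝕊 𝒢 𝒢' → RewritesTo 𝕊 (𝒢.comp ℋ) (𝒢'.comp ℋ) := by
  rintro ⟨ρ, hρ, m, 𝒢₁, h, he⟩
  obtain ⟨m', -, hm'⟩ := exists_matching_comp_left h.1 (isComp_comp 𝒢 ℋ)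
  exact ⟨ρ, hρ, m', 𝒢₁.comp ℋ, hm' _ _ h (isComp_comp 𝒢₁ ℋ), he.comp_left⟩

theorem RewritesTo.comp_right : RewritesTo 𝕊 ℋ ℋ' → RewritesTo 𝕊 (𝒢.comp ℋ) (𝒢.comp ℋ') := by
  rintro ⟨ρ, hρ, n, ℋ₁, h, he⟩
  obtain ⟨n', -, hn'⟩ := exists_matching_comp_right h.1 (isComp_comp 𝒢 ℋ)
  exact ⟨ρ, hρ, n', 𝒢.comp ℋ₁, hn' _ _ h (isComp_comp 𝒢 ℋ₁), he.comp_right⟩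

theorem RewriteEquiv.comp_left (h : RewriteEquiv 𝕊 𝒢 𝒢') :
    RewriteEquiv 𝕊 (𝒢.comp ℋ) (𝒢'.comp ℋ) :=
  Setoid.eqvGen_le (s := (Relation.EqvGen.setoid _).comap (DCospan.comp · ℋ))
    (fun _ _ => Or.rec (·.comp_left.rewriteEquiv) (·.comp_left.rewriteEquiv)) h

theorem RewriteEquiv.comp_right (h : RewriteEquiv 𝕊 ℋ ℋ') :
    RewriteEquiv 𝕊 (𝒢.comp ℋ) (𝒢.comp ℋ') :=
  Setoid.eqvGen_le (s := (Relation.EqvGen.setoid _).comap (DCospan.comp 𝒢))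
    (fun _ _ => Or.rec (·.comp_right.rewriteEquiv) (·.comp_right.rewriteEquiv)) h

theorem RewriteEquiv.comp (h : RewriteEquiv 𝕊 𝒢 𝒢') (h' : RewriteEquiv 𝕊 ℋ ℋ') :
    RewriteEquiv 𝕊 (𝒢.comp ℋ) (𝒢'.comp ℋ') :=
  .trans _ _ _ h.comp_left h'.comp_right

theorem RewriteEquiv.of_isComp {𝒦 𝒦' : DCospan T X Z} (h : RewriteEquiv 𝕊 𝒢 𝒢')
    (h' : RewriteEquiv 𝕊 ℋ ℋ') (h𝒦 : IsComp 𝒢 ℋ 𝒦) (h𝒦' : IsComp 𝒢' ℋ' 𝒦') :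
    RewriteEquiv 𝕊 𝒦 𝒦' :=
  .trans _ _ _ (h𝒦.unique (isComp_comp 𝒢 ℋ)).rewriteEquiv
    (.trans _ _ _ (h.comp h') ((isComp_comp 𝒢' ℋ').unique h𝒦').rewriteEquiv)

end Congruence

end DCospan

namespace RewriteHom

open DCospan

variable {𝕊 : Set (RewriteRule T)} {W X Y Z : List O}

/-- Composition in the rewrite category, in diagrammatic order like `DCospan.comp`. -/
noncomputable def comp (f : RewriteHom 𝕊 X Y) (g : RewriteHom 𝕊 Y Z) : RewriteHom 𝕊 X Z :=
  Quotient.map₂ DCospan.comp (fun _ _ h _ _ h' => RewriteEquiv.comp (𝕊 := 𝕊) h h') f g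

theorem comp_mk {𝒢 : DCospan T X Y} {ℋ : DCospan T Y Z} {𝒦 : DCospan T X Z}
    (h : IsComp 𝒢 ℋ 𝒦) : comp (mk 𝕊 𝒢) (mk 𝕊 ℋ) = mk 𝕊 𝒦 :=
  Quotient.sound ((isComp_comp 𝒢 ℋ).unique h).rewriteEquiv

theorem id_comp (f : RewriteHom 𝕊 X Y) : comp (mk 𝕊 (identity X)) f = f :=
  Quotient.inductionOn f fun 𝒢 => comp_mk (isComp_identity_left 𝒢)

theorem comp_id (f : RewriteHom 𝕊 X Y) : comp f (mk 𝕊 (identity Y)) = f :=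
  Quotient.inductionOn f fun 𝒢 => comp_mk (isComp_identity_right 𝒢)

theorem assoc (f : RewriteHom 𝕊 W X) (g : RewriteHom 𝕊 X Y) (h : RewriteHom 𝕊 Y Z) :
    comp (comp f g) h = comp f (comp g h) :=
  Quotient.inductionOn₃ f g h fun 𝒜 𝒢 ℋ => Eq.symm <|
    comp_mk ((isComp_comp 𝒜 𝒢).assoc (isComp_comp 𝒢 ℋ) (isComp_comp (𝒜.comp 𝒢) ℋ))

end RewriteHom

end TypedOpenGraph

open TypedOpenGraph DCospan in
theorem mainTheorem12 {O A : Type u} (T : A → List O × List O) :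
    -- composites exist and are unique up to isomorphism of cospans
    (∀ {X Y Z : List O} (𝒢 : DCospan T X Y) (ℋ : DCospan T Y Z),
      (∃ 𝒦, IsComp 𝒢 ℋ 𝒦) ∧ ∀ 𝒦 𝒦', IsComp 𝒢 ℋ 𝒦 → IsComp 𝒢 ℋ 𝒦' → Iso 𝒦 𝒦') ∧
    -- the rewritten cospan exists and is unique up to isomorphism of cospans
    (∀ {X Y : List O} (ρ : RewriteRule T) (𝒢 : DCospan T X Y) (m : ρ.L ⟶ 𝒢.graph),
      IsMatching ρ m →
      (∃ 𝒢', IsRewrite ρ 𝒢 m 𝒢') ∧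
        ∀ 𝒢' 𝒢'', IsRewrite ρ 𝒢 m 𝒢' → IsRewrite ρ 𝒢 m 𝒢'' → Iso 𝒢' 𝒢'') ∧
    -- rewriting in the first cospan of a composite
    (∀ {X Y Z : List O} (ρ : RewriteRule T) (𝒢 : DCospan T X Y) (ℋ : DCospan T Y Z)
      (m : ρ.L ⟶ 𝒢.graph), IsMatching ρ m → ∀ 𝒦, IsComp 𝒢 ℋ 𝒦 →
      ∃ m' : ρ.L ⟶ 𝒦.graph, IsMatching ρ m' ∧
        ∀ 𝒢' 𝒦' 𝒦'', IsRewrite ρ 𝒢 m 𝒢' → IsComp 𝒢' ℋ 𝒦' → IsRewrite ρ 𝒦 m' 𝒦'' →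
          Iso 𝒦' 𝒦'') ∧
    -- rewriting in the second cospan of a composite
    (∀ {X Y Z : List O} (ρ : RewriteRule T) (𝒢 : DCospan T X Y) (ℋ : DCospan T Y Z)
      (n : ρ.L ⟶ ℋ.graph), IsMatching ρ n → ∀ 𝒦, IsComp 𝒢 ℋ 𝒦 →
      ∃ n' : ρ.L ⟶ 𝒦.graph, IsMatching ρ n' ∧
        ∀ ℋ' 𝒦' 𝒦'', IsRewrite ρ ℋ n ℋ' → IsComp 𝒢 ℋ' 𝒦' → IsRewrite ρ 𝒦 n' 𝒦'' →
          Iso 𝒦' 𝒦'') ∧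
    -- rewrite equivalence is a congruence for composition
    (∀ (𝕊 : Set (RewriteRule T)) {X Y Z : List O} (𝒢 𝒢' : DCospan T X Y)
      (ℋ ℋ' : DCospan T Y Z) (𝒦 𝒦' : DCospan T X Z),
      RewriteEquiv 𝕊 𝒢 𝒢' → RewriteEquiv 𝕊 ℋ ℋ' → IsComp 𝒢 ℋ 𝒦 → IsComp 𝒢' ℋ' 𝒦' →
        RewriteEquiv 𝕊 𝒦 𝒦') ∧
    -- the rewrite category is well defined
    (∀ 𝕊 : Set (RewriteRule T),
      ∃ comp : ∀ {X Y Z : List O}, RewriteHom 𝕊 X Y → RewriteHom 𝕊 Y Z → RewriteHom 𝕊 X Z,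
        (∀ {X Y Z : List O} (𝒢 : DCospan T X Y) (ℋ : DCospan T Y Z) (𝒦 : DCospan T X Z),
          IsComp 𝒢 ℋ 𝒦 → comp (.mk 𝕊 𝒢) (.mk 𝕊 ℋ) = .mk 𝕊 𝒦) ∧
        (∀ {X Y : List O} (f : RewriteHom 𝕊 X Y), comp (.mk 𝕊 (identity X)) f = f) ∧
        (∀ {X Y : List O} (f : RewriteHom 𝕊 X Y), comp f (.mk 𝕊 (identity Y)) = f) ∧
        (∀ {W X Y Z : List O} (f : RewriteHom 𝕊 W X) (g : RewriteHom 𝕊 X Y)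
          (h : RewriteHom 𝕊 Y Z), comp (comp f g) h = comp f (comp g h))) ∧
    -- composition and rewriting restrict to cospans of graphs without isolated points
    (∀ {X Y Z : List O} (𝒢 : DCospan T X Y) (ℋ : DCospan T Y Z) (𝒦 : DCospan T X Z),
      𝒢.graph.NoIsolatedPoints → ℋ.graph.NoIsolatedPoints → IsComp 𝒢 ℋ 𝒦 →
        𝒦.graph.NoIsolatedPoints) ∧
    (∀ {X Y : List O} (ρ : RewriteRule T) (𝒢 : DCospan T X Y) (m : ρ.L ⟶ 𝒢.graph)
      (𝒢' : DCospan T X Y), IsRewrite ρ 𝒢 m 𝒢' →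
        (𝒢.graph.NoIsolatedPoints ↔ 𝒢'.graph.NoIsolatedPoints)) := by
  refine ⟨fun 𝒢 ℋ => ⟨exists_isComp 𝒢 ℋ, fun _ _ => IsComp.unique⟩,
    fun ρ 𝒢 m hm => ⟨exists_isRewrite hm, fun _ _ => IsRewrite.unique⟩,
    fun ρ 𝒢 ℋ m hm 𝒦 h𝒦 => ?_, fun ρ 𝒢 ℋ n hn 𝒦 h𝒦 => ?_,
    fun _ _ _ _ _ _ _ _ _ _ => .of_isComp,
    fun _ => ⟨RewriteHom.comp, fun _ _ _ => RewriteHom.comp_mk, RewriteHom.id_comp,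
      RewriteHom.comp_id, RewriteHom.assoc⟩,
    fun _ _ _ h𝒢 _ => IsComp.noIsolatedPoints h𝒢, fun _ _ _ _ => IsRewrite.noIsolatedPoints_iff⟩
  · obtain ⟨m', hm', hrw⟩ := exists_matching_comp_left hm h𝒦
    exact ⟨m', hm', fun _ _ _ h𝒢' h𝒦' => (hrw _ _ h𝒢' h𝒦').unique⟩
  · obtain ⟨n', hn', hrw⟩ := exists_matching_comp_right hn h𝒦
    exact ⟨n', hn', fun _ _ _ hℋ' h𝒦' => (hrw _ _ hℋ' h𝒦').unique⟩
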